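/- Let $M$ be a matroid on a finite ground set $E$ which is representable over $\mathbb{R}$, and fix a real matrix $A$ with columns indexed by $E$ representing $M$ (a subset of $E$ is independent in $M$ if and only if the corresponding columns of $A$ are linearly independent). For each circuit (resp. cocircuit) $C$ of $M$, the vectors of $\ker(A)$ (resp. of the row space of $A$) with support $C$ form two opposite rays; a signed circuit (resp. signed cocircuit) of $M$ with support $C$ is one of these two rays, identified with the vector in $\{-1,0,1\}^E$ of the signs of its elements. A signature $\sigma$ of the circuits (resp. $\sigma^*$ of the cocircuits) chooses, for each circuit (resp. cocircuit) $C$, a signed circuit $\sigma(C)$ (resp. signed cocircuit $\sigma^*(C)$) with support $C$. It is acyclic if, interpreting each value as a vector in the chosen ray, the only solution of $\sum_C a_C\,\sigma(C)=0$ (resp. $\sum_C a_C\,\sigma^*(C)=0$) with all $a_C\ge 0$ is $a_C=0$ for all $C$ (this does not depend on the choice of vectors in the rays). A discrete orientation of $M$ is a function $\mathcal{O}:E\to\{-1,1\}$. It is compatible with a signed circuit or signed cocircuit $X$ if $\mathcal{O}(e)=X(e)$ for all $e$ in the support of $X$. It is $\sigma$-compatible (resp. $\sigma^*$-compatible) if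 every signed circuit (resp. signed cocircuit) $X$ compatible with $\mathcal{O}$ satisfies $X=\sigma(\operatorname{supp}X)$ (resp. $X=\sigma^*(\operatorname{supp}X)$). Let $\mathcal{X}(M;\sigma,\sigma^*)$ be the set of discrete orientations which are both $\sigma$-compatible and $\sigma^*$-compatible. For a basis $B$ of $M$, let $\mathcal{O}_B$ be the orientation in which each $e\notin B$ has the sign of $e$ in $\sigma(C(B,e))$, where $C(B,e)$ is the fundamental circuit (the unique circuit contained in $B\cup\{e\}$), and each $e\in B$ has the sign of $e$ in $\sigma^*(C^*(B,e))$, where $C^*(B,e)$ is the fundamental cocircuit (the unique cocircuit contained in $(E\setminus B)\cup\{e\}$). **Theorem.** If $\sigma$ and $\sigma^*$ are acyclic signatures of the circuits and of the cocircuits of $M$, respectively, then every $\mathcal{O}_B$ lies in $\mathcal{X}(M;\sigma,\sigma^*)$, and the map $\hat\beta: B\mapsto\mathcal{O}_B$ is a bijection from the set of bases of $M$ onto $\mathcal{X}(M;\sigma,\sigma^*)$. -/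

import Mathlib

namespace RealMatroid

variable {ι E : Type*}

/-- The real matrix `A`, with columns indexed by `E`, represents the matroid `M` over `ℝ`:
the ground set of `M` is all of `E`, and a set is independent in `M` if and only if the
corresponding columns of `A` are linearly independent. -/
structure Represents (A : Matrix ι E ℝ) (M : Matroid E) : Prop where
  ground_eq : M.E = Set.univ
  indep_iff : ∀ I : Set E, M.Indep I ↔ LinearIndepOn ℝ A.col I

/-- The kernel of `A`, as a subspace of `ℝ^E`. -/
def kernel [Fintype E] (A : Matrix ι E ℝ) : Submodule ℝ (E → ℝ) :=
  LinearMap.ker A.mulVecLin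

/-- The row space of `A`, as a subspace of `ℝ^E`. -/
def rowSpace (A : Matrix ι E ℝ) : Submodule ℝ (E → ℝ) :=
  Submodule.span ℝ (Set.range A.row)

/-- The vector `v` lies in the ray which the sign vector `X` stands for: its coordinates have
the signs prescribed by `X`. -/
def HasSigns (v : E → ℝ) (X : E → SignType) : Prop :=
  ∀ e, SignType.sign (v e) = X e

/-- The sign vectors of those elements of `V` whose support is a circuit of `N`.
For `N = M` and `V = ker A` these are the signed circuits of `M`; for `N = M✶` and
`V = row A` they are the signed cocircuits of `M`. The elements of `V` supported on a given
circuit form two opposite rays, and a ray is recorded by its sign vector. -/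
def signedCircuits (N : Matroid E) (V : Submodule ℝ (E → ℝ)) : Set (E → SignType) :=
  {X | N.IsCircuit (Function.support X) ∧ ∃ v ∈ V, HasSigns v X}

/-- A signature: a section of the map from signed circuits to circuits which sends a signed
circuit to its support. -/
structure Signature (N : Matroid E) (V : Submodule ℝ (E → ℝ)) where
  toFun : {C : Set E // N.IsCircuit C} → E → SignType
  mem_signedCircuits : ∀ C, toFun C ∈ signedCircuits N V
  support_eq : ∀ C, Function.support (toFun C) = C.1

/-- Circuit signatures of the matroid `M` represented by `A`. -/
abbrev CircuitSignature [Fintype E] (M : Matroid E) (A : Matrix ι E ℝ) :=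
  Signature M (kernel A)

/-- Cocircuit signatures of the matroid `M` represented by `A`. -/
abbrev CocircuitSignature (M : Matroid E) (A : Matrix ι E ℝ) :=
  Signature (Matroid.dual M) (rowSpace A)

open Classical in
/-- A signature `σ` is acyclic if, each `σ C` being interpreted as a vector of `V` in the
corresponding ray (any choice of these vectors), the only non-negative solution of
`∑ a_C σ(C) = 0` is the trivial one. Rescaling the vectors rescales the coefficients, so the
condition does not depend on the choice. -/
def Signature.IsAcyclic [Fintype E] {N : Matroid E} {V : Submodule ℝ (E → ℝ)}
    (σ : Signature N V) : Prop :=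
  ∀ v : {C : Set E // N.IsCircuit C} → E → ℝ,
    (∀ C, v C ∈ V ∧ HasSigns (v C) (σ.toFun C)) →
    ∀ a : {C : Set E // N.IsCircuit C} → ℝ,
      (∀ C, 0 ≤ a C) → ∑ C, a C • v C = 0 → ∀ C, a C = 0

/-- A discrete orientation: a function from `E` to `{-1, 1}`. -/
def IsOrientation (O : E → SignType) : Prop :=
  ∀ e, O e = -1 ∨ O e = 1

/-- `O` is compatible with the signed circuit `X`: they agree on the support of `X`. -/
def CompatibleWith (O X : E → SignType) : Prop :=
  ∀ e ∈ Function.support X, O e = X e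

/-- `O` is `σ`-compatible: every signed circuit compatible with `O` is oriented according
to `σ`. -/
def Signature.Compatible {N : Matroid E} {V : Submodule ℝ (E → ℝ)}
    (σ : Signature N V) (O : E → SignType) : Prop :=
  ∀ (X : E → SignType) (hX : X ∈ signedCircuits N V),
    CompatibleWith O X → X = σ.toFun ⟨Function.support X, hX.1⟩

/-- The set `𝒳(M; σ, σ*)` of discrete `(σ, σ*)`-compatible orientations. -/
def compatibleOrientations [Fintype E] {M : Matroid E} {A : Matrix ι E ℝ}
    (σ : CircuitSignature M A) (σs : CocircuitSignature M A) : Set (E → SignType) :=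
  {O | IsOrientation O ∧ σ.Compatible O ∧ σs.Compatible O}

open Classical in
/-- The map `B ↦ O_B` on bases: `e ∉ B` is oriented as in `σ` of the fundamental circuit of
`e` and `B`, and `e ∈ B` is oriented as in `σ*` of the fundamental cocircuit of `e` and `B`. -/
noncomputable def basisOrientation [Fintype E] {M : Matroid E} {A : Matrix ι E ℝ}
    (hA : Represents A M) (σ : CircuitSignature M A) (σs : CocircuitSignature M A)
    (B : {B : Set E // M.IsBase B}) : E → SignType := fun e =>
  if he : e ∈ B.1 then
    σs.toFun ⟨M.fundCocircuit e B.1, (Matroid.fundCocircuit_isCocircuit he B.2).isCircuit⟩ e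
  else
    σ.toFun ⟨M.fundCircuit e B.1,
      B.2.fundCircuit_isCircuit (hA.ground_eq ▸ Set.mem_univ e) he⟩ e

end RealMatroid

namespace RealMatroid

open Matrix

section Duality

/-- Every linear functional on `ι → ℝ` is the dot product with a vector. -/
theorem exists_dotProduct_eq {ι : Type*} [Fintype ι] (f : (ι → ℝ) →ₗ[ℝ] ℝ) :
    ∃ c : ι → ℝ, ∀ x, f x = c ⬝ᵥ x := by
  classical
  refine ⟨fun i => f (Pi.single i 1), fun x => ?_⟩
  conv_lhs => rw [pi_eq_sum_univ' x]
  simp only [map_sum, map_smul, smul_eq_mul, dotProduct]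
  exact Finset.sum_congr rfl fun i _ => mul_comm _ _

/-- Farkas' lemma: an affine subspace `w + range L` of `ℝ^ι` either meets the open positive
orthant, or there is a non-negative vector certifying that it does not. -/
theorem exists_pos_or_exists_nonneg {ι F : Type*} [Fintype ι] [AddCommGroup F] [Module ℝ F]
    (L : F →ₗ[ℝ] (ι → ℝ)) (w : ι → ℝ) :
    (∃ x, ∀ i, 0 < w i + L x i) ∨
      ∃ c : ι → ℝ, (∀ i, 0 ≤ c i) ∧ c ≠ 0 ∧ (∀ x, c ⬝ᵥ L x = 0) ∧ c ⬝ᵥ w ≤ 0 := by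
  classical
  refine or_iff_not_imp_left.2 fun hno => ?_
  set P : Set (ι → ℝ) := Set.univ.pi fun _ => Set.Ioi 0
  set T : Set (ι → ℝ) := Set.range fun x => w + L x
  have hPc : Convex ℝ P := convex_pi fun _ _ => convex_Ioi 0
  have hPo : IsOpen P := isOpen_set_pi Set.finite_univ fun _ _ => isOpen_Ioi
  have hTc : Convex ℝ T := by
    rintro _ ⟨x, rfl⟩ _ ⟨y, rfl⟩ a b _ _ hab
    refine ⟨a • x + b • y, ?_⟩
    simp only [map_add, map_smul, smul_add]
    nth_rewrite 1 [← one_smul ℝ w]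
    rw [← hab, add_smul]
    abel
  have hd : Disjoint P T := by
    rw [Set.disjoint_left]
    rintro _ hy ⟨x, rfl⟩
    exact hno ⟨x, fun i => by simpa using hy i trivial⟩
  obtain ⟨f, u, hfP, hfT⟩ := geometric_hahn_banach_open hPc hPo hTc hd
  obtain ⟨d, hd⟩ := exists_dotProduct_eq (f : (ι → ℝ) →ₗ[ℝ] ℝ)
  replace hd : ∀ x, f x = d ⬝ᵥ x := hd
  have hmem : ∀ (g : ι → ℝ), (∀ i, 0 ≤ g i) → ∀ ε > 0, (fun i => g i + ε) ∈ P :=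
    fun g hg ε hε i _ => add_pos_of_nonneg_of_pos (hg i) hε
  have hle : ∀ g : ι → ℝ, (∀ i, 0 ≤ g i) → d ⬝ᵥ g ≤ u := by
    intro g hg
    have hc : Continuous fun ε : ℝ => f fun i => g i + ε := f.continuous.comp (by fun_prop)
    have ht : Filter.Tendsto (fun ε : ℝ => f fun i => g i + ε) (nhdsWithin 0 (Set.Ioi 0))
        (nhds (f g)) := by
      have := (hc.tendsto 0).mono_left (nhdsWithin_le_nhds (s := Set.Ioi (0 : ℝ)))
      simpa using this
    rw [← hd]
    exact le_of_tendsto ht (Filter.eventually_of_mem self_mem_nhdsWithin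
      fun ε hε => (hfP _ (hmem g hg ε hε)).le)
  have hu : 0 ≤ u := by simpa using hle 0 fun _ => le_rfl
  have hL : ∀ x, d ⬝ᵥ L x = 0 := by
    intro x
    by_contra hx
    have h : u ≤ f (w + L _) := hfT _ ⟨((u - 1 - d ⬝ᵥ w) / (d ⬝ᵥ L x)) • x, rfl⟩
    rw [hd, map_smul, dotProduct_add, dotProduct_smul, smul_eq_mul, div_mul_cancel₀ _ hx] at h
    linarith
  have hw : u ≤ d ⬝ᵥ w := by
    have h : u ≤ f (w + L 0) := hfT _ ⟨0, rfl⟩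
    rwa [map_zero, add_zero, hd] at h
  refine ⟨-d, fun i => ?_, ?_, fun x => ?_, ?_⟩
  · by_contra! hi
    simp only [Pi.neg_apply, Left.neg_neg_iff] at hi
    have h := hle (Pi.single i ((u + 1) / d i)) fun j => by
      rcases eq_or_ne j i with rfl | hj
      · simpa using by positivity
      · simp [hj]
    rw [dotProduct_single, mul_div_cancel₀ _ hi.ne'] at h
    linarith
  · intro h0
    have h := hfP _ (hmem 0 (fun _ => le_rfl) 1 one_pos)
    rw [hd, neg_eq_zero.1 h0, zero_dotProduct] at h
    rw [neg_eq_zero.1 h0, zero_dotProduct] at hw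
    linarith
  · rw [neg_dotProduct, hL, neg_zero]
  · rw [neg_dotProduct]
    linarith

variable {ι E : Type*}

/-- `V` is the space of linear dependencies of a configuration representing `N`. -/
structure IsDependencySpace (N : Matroid E) (V : Submodule ℝ (E → ℝ)) : Prop where
  ground_eq : N.E = Set.univ
  indep_iff : ∀ I : Set E, N.Indep I ↔ ∀ v ∈ V, Function.support v ⊆ I → v = 0

/-- An element that depends on an independent set `J` is in the support of a vector of `V`
supported on it and `J`. -/
theorem IsDependencySpace.exists_mem_of_not_indep_insert {N : Matroid E} {V : Submodule ℝ (E → ℝ)}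
    (h : IsDependencySpace N V) {J : Set E} {x : E}
    (hJ : N.Indep J) (hx : ¬ N.Indep (insert x J)) :
    ∃ v ∈ V, Function.support v ⊆ insert x J ∧ v x ≠ 0 := by
  rw [h.indep_iff] at hx
  push Not at hx
  obtain ⟨v, hv, hvs, hv0⟩ := hx
  refine ⟨v, hv, hvs, fun hvx => hv0 ((h.indep_iff J).1 hJ v hv fun y hy => ?_)⟩
  rcases hvs hy with rfl | hy'
  · exact absurd hvx hy
  · exact hy'

variable [Fintype E]

/-- The orthogonal complement of a subspace of `ℝ^E` for the dot product. -/
def perp (V : Submodule ℝ (E → ℝ)) : Submodule ℝ (E → ℝ) where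
  carrier := {u | ∀ v ∈ V, u ⬝ᵥ v = 0}
  add_mem' ha hb v hv := by rw [add_dotProduct, ha v hv, hb v hv, add_zero]
  zero_mem' v _ := zero_dotProduct v
  smul_mem' c x hx v hv := by rw [smul_dotProduct, hx v hv, smul_zero]

theorem exists_mem_perp_of_notMem {W : Submodule ℝ (E → ℝ)} {x : E → ℝ} (hx : x ∉ W) :
    ∃ z ∈ perp W, z ⬝ᵥ x ≠ 0 := by
  obtain ⟨f, hfx, hfW⟩ := Submodule.exists_le_ker_of_notMem hx
  obtain ⟨z, hz⟩ := exists_dotProduct_eq f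
  exact ⟨z, fun v hv => by rw [← hz]; exact hfW hv, by rwa [← hz]⟩

theorem perp_perp (V : Submodule ℝ (E → ℝ)) : perp (perp V) = V := by
  refine le_antisymm (fun x hx => ?_) fun v hv u hu => by rw [dotProduct_comm, hu v hv]
  by_contra hxV
  obtain ⟨z, hz, hzx⟩ := exists_mem_perp_of_notMem hxV
  exact hzx (by rw [dotProduct_comm, hx z hz])

theorem perp_rowSpace (A : Matrix ι E ℝ) : perp (rowSpace A) = kernel A := by
  ext v
  constructor
  · intro hv
    change A *ᵥ v = 0
    funext i
    rw [Matrix.mulVec, dotProduct_comm]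
    exact hv _ (Submodule.subset_span ⟨i, rfl⟩)
  · intro hv u hu
    rw [dotProduct_comm]
    change A *ᵥ v = 0 at hv
    induction hu using Submodule.span_induction with
    | mem x hx =>
      obtain ⟨i, rfl⟩ := hx
      exact congrFun hv i
    | zero => exact zero_dotProduct v
    | add x y _ _ hx hy => rw [add_dotProduct, hx, hy, add_zero]
    | smul a x _ hx => rw [smul_dotProduct, hx, smul_zero]

theorem perp_kernel (A : Matrix ι E ℝ) : perp (kernel A) = rowSpace A := by
  rw [← perp_rowSpace, perp_perp]

theorem Represents.isDependencySpace_kernel {A : Matrix ι E ℝ} {M : Matroid E}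
    (hA : Represents A M) : IsDependencySpace M (kernel A) := by
  classical
  refine ⟨hA.ground_eq, fun I => ?_⟩
  rw [hA.indep_iff, linearIndepOn_iff]
  have key : ∀ v : E → ℝ, ∑ e, v e • A.col e = A *ᵥ v := by
    intro v
    funext i
    simp [Matrix.mulVec, dotProduct, mul_comm]
  constructor
  · intro h v hv hvI
    have := h (Finsupp.equivFunOnFinite.symm v) ((Finsupp.mem_supported' _ _).2
      fun e he => by_contra fun h' => he (hvI h')) (by
        rw [Finsupp.linearCombination_apply, Finsupp.sum_fintype _ _ (by simp)]
        exact (key v).trans hv)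
    exact funext fun e => DFunLike.congr_fun this e
  · intro h l hl h0
    have := h l (by
      change A *ᵥ l = 0
      rw [← key, ← h0, Finsupp.linearCombination_apply, Finsupp.sum_fintype _ _ (by simp)])
      (by rwa [Finsupp.fun_support_eq])
    exact DFunLike.coe_injective this

namespace IsDependencySpace

variable {N : Matroid E} {V : Submodule ℝ (E → ℝ)}

/-- Vectors of `perp V` take arbitrary values on an independent set. -/
theorem exists_mem_perp_eqOn (h : IsDependencySpace N V) {I : Set E} (hI : N.Indep I)
    (f : E → ℝ) : ∃ u ∈ perp V, ∀ e ∈ I, u e = f e := by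
  classical
  let K : Submodule ℝ (E → ℝ) :=
    { carrier := {g | ∀ e ∈ I, g e = 0}
      add_mem' := fun ha hb e he => by simp [ha e he, hb e he]
      zero_mem' := fun _ _ => rfl
      smul_mem' := fun c x hx e he => by simp [hx e he] }
  have hf : f ∈ perp V ⊔ K := by
    by_contra hf
    obtain ⟨z, hz, hzf⟩ := exists_mem_perp_of_notMem hf
    have hzV : z ∈ V := by
      rw [← perp_perp V]
      exact fun v hv => hz v (Submodule.mem_sup_left hv)
    have hzI : Function.support z ⊆ I := by
      intro e he
      by_contra heI
      have := hz (Pi.single e 1) (Submodule.mem_sup_right fun e' he' =>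
        Pi.single_eq_of_ne (by rintro rfl; exact heI he') _)
      exact he (by simpa using this)
    exact hzf (by rw [(h.indep_iff I).1 hI z hzV hzI, zero_dotProduct])
  obtain ⟨u, hu, k, hk, rfl⟩ := Submodule.mem_sup.1 hf
  exact ⟨u, hu, fun e he => by simp [hk e he]⟩

end IsDependencySpace

theorem dotProduct_eq_mul_of_support_subset {u v : E → ℝ} {J : Set E} {x : E}
    (hv : Function.support v ⊆ insert x J) (hu : ∀ y ∈ J, u y = 0) : u ⬝ᵥ v = u x * v x := by
  classical
  rw [dotProduct, Finset.sum_eq_single x _ (by simp)]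
  intro y _ hyx
  by_contra hy
  exact left_ne_zero_of_mul hy
    (hu y ((hv (right_ne_zero_of_mul hy : v y ≠ 0)).resolve_left hyx))

namespace IsDependencySpace

variable {N : Matroid E} {V : Submodule ℝ (E → ℝ)}

theorem dual (h : IsDependencySpace N V) : IsDependencySpace N✶ (perp V) := by
  classical
  refine ⟨h.ground_eq, fun I => ?_⟩
  rw [Matroid.dual_indep_iff_exists (by simp [h.ground_eq])]
  constructor
  · rintro ⟨B, hB, hdisj⟩ u hu huI
    have huB : ∀ y ∈ B, u y = 0 := fun y hy => by_contra fun hy' =>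
      Set.disjoint_left.1 hdisj (huI hy') hy
    funext e
    by_contra he
    have heB : e ∉ B := fun h' => he (huB e h')
    obtain ⟨v, hv, hvs, hve⟩ := h.exists_mem_of_not_indep_insert hB.indep fun hi =>
      heB (by rw [hB.eq_of_subset_indep hi (Set.subset_insert _ _)]; exact Set.mem_insert _ _)
    exact mul_ne_zero he hve ((dotProduct_eq_mul_of_support_subset hvs huB).symm.trans (hu v hv))
  · intro hI
    obtain ⟨J, hJ⟩ := N.exists_isBasis Iᶜ (by simp [h.ground_eq])
    refine ⟨J, hJ.indep.isBase_of_forall_insert fun e he hins => ?_,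
      Set.disjoint_left.2 fun x hx hxJ => hJ.subset hxJ hx⟩
    obtain ⟨u, hu, huJ⟩ := h.exists_mem_perp_eqOn hins (Pi.single e 1)
    have hu0 : ∀ x ∈ J, u x = 0 := fun x hx => by
      rw [huJ x (Set.mem_insert_of_mem _ hx), Pi.single_eq_of_ne]
      rintro rfl
      exact he.2 hx
    have hue : u e = 1 := by rw [huJ e (Set.mem_insert _ _), Pi.single_eq_same]
    have : u = 0 := by
      refine hI u hu fun x hx => ?_
      by_contra hxI
      obtain ⟨v, hv, hvs, hvx⟩ := h.exists_mem_of_not_indep_insert hJ.indep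
        (hJ.insert_dep ⟨hxI, fun hxJ => hx (hu0 x hxJ)⟩).not_indep
      exact mul_ne_zero hx hvx
        ((dotProduct_eq_mul_of_support_subset hvs hu0).symm.trans (hu v hv))
    simp [this] at hue

end IsDependencySpace

end Duality

section SignatureVectors

section Signs

theorem sign_eq_sign_of_mul_pos {a b : ℝ} (h : 0 < a * b) :
    SignType.sign a = SignType.sign b := by
  rcases pos_and_pos_or_neg_and_neg_of_mul_pos h with ⟨ha, hb⟩ | ⟨ha, hb⟩
  · rw [sign_pos ha, sign_pos hb]
  · rw [sign_neg ha, sign_neg hb]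

theorem mul_pos_of_sign_eq_sign {a b : ℝ} (h : SignType.sign a = SignType.sign b) (hb : b ≠ 0) :
    0 < a * b := by
  rcases hb.lt_or_gt with hb | hb
  · rw [sign_neg hb, sign_eq_neg_one_iff] at h
    exact mul_pos_of_neg_of_neg h hb
  · rw [sign_pos hb, sign_eq_one_iff] at h
    exact mul_pos h hb

variable {E : Type*}

theorem IsOrientation.sign_eq_iff {O : E → SignType} (hO : IsOrientation O) (e : E) (x : ℝ) :
    SignType.sign x = O e ↔ 0 < (O e : ℝ) * x := by
  rcases hO e with h | h <;> simp [h, sign_eq_one_iff, sign_eq_neg_one_iff]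

theorem IsOrientation.mul_self {O : E → SignType} (hO : IsOrientation O) (e : E) :
    (O e : ℝ) * (O e : ℝ) = 1 := by
  rcases hO e with h | h <;> simp [h]

theorem HasSigns.support_eq {v : E → ℝ} {X : E → SignType} (h : HasSigns v X) :
    Function.support v = Function.support X := by
  ext e
  rw [Function.mem_support, Function.mem_support, ← h e, ne_eq, ne_eq, sign_eq_zero_iff]

end Signs

variable {E : Type*} {N : Matroid E} {V : Submodule ℝ (E → ℝ)}

/-- Vectors of `V` supported on a common circuit are proportional. -/
theorem IsDependencySpace.exists_eq_smul (h : IsDependencySpace N V) {C : Set E}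
    (hC : N.IsCircuit C) {v v' : E → ℝ} (hv : v ∈ V) (hv' : v' ∈ V)
    (hs : Function.support v = C) (hs' : Function.support v' = C) : ∃ t : ℝ, v = t • v' := by
  obtain ⟨e, he⟩ := hC.nonempty
  have hve : v' e ≠ 0 := by
    rw [← hs'] at he
    exact he
  refine ⟨v e / v' e, sub_eq_zero.1 ((h.indep_iff _).1 (hC.sdiff_singleton_indep he) _
    (V.sub_mem hv (V.smul_mem _ hv')) fun x hx => ⟨?_, ?_⟩)⟩
  · by_contra hxC
    have h1 : v x = 0 := by
      rw [← hs] at hxC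
      exact Function.notMem_support.1 hxC
    have h2 : v' x = 0 := by
      rw [← hs'] at hxC
      exact Function.notMem_support.1 hxC
    exact hx (by simp [h1, h2])
  · rintro rfl
    exact hx (by simp [hve])

variable [Fintype E]

theorem dotProduct_congr_of_sub_mem_perp {w y v : E → ℝ} (hy : y - w ∈ perp V) (hv : v ∈ V) :
    w ⬝ᵥ v = y ⬝ᵥ v := by
  have := hy v hv
  rw [sub_dotProduct] at this
  linarith

/-- The signature `σ` is induced by `w`: it chooses the rays having positive dot product
with `w`. -/
def Signature.IsInducedBy (σ : Signature N V) (w : E → ℝ) : Prop :=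
  ∀ C, ∀ v ∈ V, HasSigns v (σ.toFun C) → 0 < w ⬝ᵥ v

theorem Signature.eq_of_dotProduct_pos (h : IsDependencySpace N V) {σ : Signature N V}
    {w : E → ℝ} (hw : σ.IsInducedBy w) (C : {C : Set E // N.IsCircuit C}) {X : E → SignType}
    (hXC : Function.support X = C.1) {v : E → ℝ}
    (hv : v ∈ V) (hvX : HasSigns v X) (hpos : 0 < w ⬝ᵥ v) : X = σ.toFun C := by
  obtain ⟨-, v', hv', hs'⟩ := σ.mem_signedCircuits C
  obtain ⟨t, rfl⟩ := h.exists_eq_smul C.2 hv hv' (hvX.support_eq.trans hXC)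
    (hs'.support_eq.trans (σ.support_eq C))
  rw [dotProduct_smul, smul_eq_mul] at hpos
  have ht : 0 < t := pos_of_mul_pos_left hpos (hw C v' hv' hs').le
  funext e
  rw [← hvX e, ← hs' e, Pi.smul_apply, smul_eq_mul, sign_mul, sign_pos ht, one_mul]

theorem Signature.IsAcyclic.exists_isInducedBy (h : IsDependencySpace N V) {σ : Signature N V}
    (hσ : σ.IsAcyclic) : ∃ w, σ.IsInducedBy w := by
  classical
  choose v hv hs using fun C => (σ.mem_signedCircuits C).2
  rcases exists_pos_or_exists_nonneg (Matrix.of v).mulVecLin 0 with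
    ⟨w, hw⟩ | ⟨c, hc, hc0, hcv, -⟩
  · refine ⟨w, fun C v' hv' hs' => ?_⟩
    have hwC : 0 < w ⬝ᵥ v C := by
      rw [dotProduct_comm]
      simpa [Matrix.mulVec] using hw C
    obtain ⟨t, rfl⟩ := h.exists_eq_smul C.2 hv' (hv C) (hs'.support_eq.trans (σ.support_eq C))
      ((hs C).support_eq.trans (σ.support_eq C))
    obtain ⟨e, he⟩ := C.2.nonempty
    rw [← σ.support_eq C, ← (hs C).support_eq] at he
    have hsign := (hs' e).trans (hs C e).symm
    have ht : 0 < t * v C e * v C e := mul_pos_of_sign_eq_sign hsign he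
    rw [mul_assoc] at ht
    rw [dotProduct_smul, smul_eq_mul]
    exact mul_pos (pos_of_mul_pos_left ht (mul_self_nonneg _)) hwC
  · refine absurd (funext fun C => ?_) hc0
    refine hσ v (fun C => ⟨hv C, hs C⟩) c hc ?_ C
    have h0 : c ᵥ* Matrix.of v = 0 := by
      refine dotProduct_eq_zero _ fun x => ?_
      rw [← Matrix.dotProduct_mulVec]
      exact hcv x
    rw [← h0, Matrix.vecMul_eq_sum]
    rfl

/-- The zero set of a vector of `w + perp V` is independent: `w` is generic. -/
theorem Signature.IsInducedBy.indep_zeros (h : IsDependencySpace N V) {σ : Signature N V}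
    {w y : E → ℝ} (hw : σ.IsInducedBy w) (hy : y - w ∈ perp V) : N.Indep {e | y e = 0} := by
  by_contra hdep
  obtain ⟨C, hCs, hC⟩ := Matroid.Dep.exists_isCircuit_subset
    ((Matroid.not_indep_iff (by simp [h.ground_eq])).1 hdep)
  obtain ⟨-, v, hv, hs⟩ := σ.mem_signedCircuits ⟨C, hC⟩
  have hpos := hw _ v hv hs
  rw [dotProduct_congr_of_sub_mem_perp hy hv, dotProduct, Finset.sum_eq_zero] at hpos
  · exact hpos.false
  · intro e _
    by_contra he
    have heC : e ∈ C := by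
      have hsC := hs.support_eq.trans (σ.support_eq ⟨C, hC⟩)
      exact hsC.subset (right_ne_zero_of_mul he)
    exact left_ne_zero_of_mul he (hCs heC)

theorem Signature.compatible_of_sign_eq (h : IsDependencySpace N V) {σ : Signature N V}
    {w y : E → ℝ} (hw : σ.IsInducedBy w) (hy : y - w ∈ perp V) {O : E → SignType} {I : Set E}
    (hI : N.Indep I) (hyI : ∀ e ∈ I, y e = 0) (hyO : ∀ e ∉ I, O e = SignType.sign (y e)) :
    σ.Compatible O := by
  intro X hX hOX
  obtain ⟨hC, v, hv, hs⟩ := hX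
  refine eq_of_dotProduct_pos h hw _ rfl hv hs ?_
  rw [dotProduct_congr_of_sub_mem_perp hy hv]
  have hpos : ∀ e ∈ Function.support v, e ∉ I → 0 < y e * v e := by
    intro e he heI
    refine mul_pos_of_sign_eq_sign ?_ he
    rw [hs.support_eq] at he
    rw [← hyO e heI, hOX e he, hs e]
  obtain ⟨e, heX, heI⟩ := Set.not_subset.1 fun hs => hC.dep.not_indep (hI.subset hs)
  rw [← hs.support_eq] at heX
  refine Finset.sum_pos' (fun x _ => ?_) ⟨e, Finset.mem_univ _, hpos e heX heI⟩
  by_cases hxI : x ∈ I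
  · simp [hyI x hxI]
  by_cases hxv : v x = 0
  · simp [hxv]
  · exact (hpos x hxv hxI).le

theorem Signature.Compatible.dotProduct_pos (h : IsDependencySpace N V) {σ : Signature N V}
    {w : E → ℝ} (hw : σ.IsInducedBy w) {O : E → SignType} (hO : IsOrientation O)
    (hσO : σ.Compatible O) {v : E → ℝ} (hv : v ∈ V) (hv0 : v ≠ 0)
    (hvO : ∀ e, 0 ≤ (O e : ℝ) * v e) : 0 < w ⬝ᵥ v := by
  classical
  induction hn : (Function.support v).ncard using Nat.strong_induction_on generalizing v with
  | _ n ih =>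
  have hdep : N.Dep (Function.support v) := (Matroid.not_indep_iff (by simp [h.ground_eq])).1
    fun hi => hv0 ((h.indep_iff _).1 hi v hv subset_rfl)
  obtain ⟨C, hCv, hC⟩ := hdep.exists_isCircuit_subset
  rcases hCv.eq_or_ssubset with rfl | hlt
  · have hsupp : Function.support (fun e => SignType.sign (v e)) = Function.support v :=
      (HasSigns.support_eq (v := v) fun _ => rfl).symm
    have hX : (fun e => SignType.sign (v e)) ∈ signedCircuits N V :=
      ⟨by rwa [hsupp], v, hv, fun _ => rfl⟩
    have hcomp := hσO _ hX fun e he => by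
      rw [hsupp] at he
      refine ((hO.sign_eq_iff e _).2 ((hvO e).lt_of_ne' (mul_ne_zero ?_ he))).symm
      exact left_ne_zero_of_mul (by rw [hO.mul_self]; exact one_ne_zero)
    exact hw _ v hv fun e => congrFun hcomp e
  · obtain ⟨z, hz, hzC, hz0, hwz⟩ :
        ∃ z ∈ V, Function.support z ⊆ C ∧ z ≠ 0 ∧ w ⬝ᵥ z ≤ 0 := by
      have hni := hC.dep.not_indep
      rw [h.indep_iff] at hni
      push Not at hni
      obtain ⟨z, hz, hzC, hz0⟩ := hni
      rcases le_total (w ⬝ᵥ z) 0 with hwz | hwz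
      · exact ⟨z, hz, hzC, hz0, hwz⟩
      · exact ⟨-z, V.neg_mem hz, by rwa [Function.support_neg], neg_ne_zero.2 hz0,
          by rw [dotProduct_neg]; linarith⟩
    have hzv : Function.support z ⊂ Function.support v := hzC.trans_ssubset hlt
    by_cases hneg : ∃ e, (O e : ℝ) * z e < 0
    · obtain ⟨e, he, hmin⟩ := Finset.exists_min_image
        (Finset.univ.filter fun e => (O e : ℝ) * z e < 0)
        (fun e => (O e : ℝ) * v e / -((O e : ℝ) * z e)) (by simpa [Finset.Nonempty] using hneg)
      simp only [Finset.mem_filter, Finset.mem_univ, true_and] at he hmin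
      set t := (O e : ℝ) * v e / -((O e : ℝ) * z e) with ht
      have ht0 : 0 ≤ t := div_nonneg (hvO e) (by linarith)
      have hOe : (O e : ℝ) ≠ 0 := left_ne_zero_of_mul he.ne
      have hze : z e ≠ 0 := right_ne_zero_of_mul he.ne
      have hzero : (v + t • z) e = 0 := by
        rw [Pi.add_apply, Pi.smul_apply, smul_eq_mul, ht]
        field_simp
        ring
      have hsub : Function.support (v + t • z) ⊂ Function.support v := by
        refine (Set.ssubset_iff_of_subset fun x hx => ?_).2
          ⟨e, hzv.subset hze, Function.notMem_support.2 hzero⟩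
        by_contra hxv
        have hxz : z x = 0 := Function.notMem_support.1 fun h' => hxv (hzv.subset h')
        exact hx (by simp [Function.notMem_support.1 hxv, hxz])
      have hpos := ih _ (hn ▸ Set.ncard_lt_ncard hsub) (V.add_mem hv (V.smul_mem t hz)) (by
        obtain ⟨x, hxv, hxz⟩ := Set.exists_of_ssubset hzv
        intro h0
        have hx0 := congrFun h0 x
        rw [Pi.add_apply, Pi.smul_apply, Function.notMem_support.1 hxz, smul_zero,
          add_zero] at hx0
        exact hxv hx0) (fun x => by
        rw [Pi.add_apply, Pi.smul_apply, smul_eq_mul, mul_add, mul_left_comm]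
        rcases lt_or_ge ((O x : ℝ) * z x) 0 with hx | hx
        · have := hmin x hx
          rw [le_div_iff₀ (by linarith)] at this
          linarith
        · exact add_nonneg (hvO x) (mul_nonneg ht0 hx)) rfl
      rw [dotProduct_add, dotProduct_smul, smul_eq_mul] at hpos
      have := mul_nonpos_of_nonneg_of_nonpos ht0 hwz
      linarith
    · push Not at hneg
      exact absurd (ih _ (hn ▸ Set.ncard_lt_ncard hzv) hz hz0 hneg rfl) hwz.not_gt

theorem Signature.Compatible.exists_hasSigns (h : IsDependencySpace N V) {σ : Signature N V}
    {w : E → ℝ} (hw : σ.IsInducedBy w) {O : E → SignType} (hO : IsOrientation O)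
    (hσO : σ.Compatible O) : ∃ y, y - w ∈ perp V ∧ HasSigns y O := by
  set o : E → ℝ := fun e => (O e : ℝ) with ho
  rcases exists_pos_or_exists_nonneg ((LinearMap.mulLeft ℝ o).comp (perp V).subtype) (o * w) with
    ⟨u, hu⟩ | ⟨c, hc, hc0, hcV, hcw⟩
  · refine ⟨w + u, by simp, fun e => (hO.sign_eq_iff e _).2 ?_⟩
    simpa [mul_add, ho] using hu e
  · have hassoc : ∀ x : E → ℝ, c ⬝ᵥ (o * x) = x ⬝ᵥ (o * c) := fun x =>
      Finset.sum_congr rfl fun e _ => by simp only [Pi.mul_apply]; ring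
    have hoc : o * c ∈ V := by
      rw [← perp_perp V]
      intro u hu
      rw [dotProduct_comm, ← hassoc]
      exact hcV ⟨u, hu⟩
    have hoo : ∀ e, (O e : ℝ) * (o * c) e = c e := fun e => by
      rw [Pi.mul_apply, ← mul_assoc, hO.mul_self, one_mul]
    refine absurd (hσO.dotProduct_pos h hw hO hoc (fun h0 => hc0 (funext fun e => ?_))
      fun e => by rw [hoo]; exact hc e) (by rw [← hassoc]; exact hcw.not_gt)
    rw [← hoo, h0, Pi.zero_apply, mul_zero]

theorem IsDependencySpace.exists_sub_mem_perp_eq_zero (h : IsDependencySpace N V) {I : Set E}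
    (hI : N.Indep I) (w : E → ℝ) : ∃ y, y - w ∈ perp V ∧ ∀ e ∈ I, y e = 0 := by
  obtain ⟨u, hu, huI⟩ := h.exists_mem_perp_eqOn hI (-w)
  exact ⟨w + u, by simpa, fun e he => by simp [huI e he]⟩

theorem Signature.IsInducedBy.apply_eq_sign {σ : Signature N V} {w y : E → ℝ}
    (hw : σ.IsInducedBy w) (hy : y - w ∈ perp V) {I : Set E} (hyI : ∀ e ∈ I, y e = 0)
    (C : {C : Set E // N.IsCircuit C}) {e : E} (hCI : C.1 ⊆ insert e I) :
    y e ≠ 0 ∧ σ.toFun C e = SignType.sign (y e) := by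
  obtain ⟨-, v, hv, hs⟩ := σ.mem_signedCircuits C
  have hpos := hw _ v hv hs
  rw [dotProduct_congr_of_sub_mem_perp hy hv, dotProduct_eq_mul_of_support_subset
    (by rwa [hs.support_eq, σ.support_eq C]) hyI] at hpos
  exact ⟨left_ne_zero_of_mul hpos.ne', by rw [← hs e, sign_eq_sign_of_mul_pos hpos]⟩

end SignatureVectors

section BasisOrientations

variable {ι E : Type*}

theorem Represents.isBase_compl {A : Matrix ι E ℝ} {M : Matroid E}
    (hA : Represents A M) {B : Set E} (hB : M.IsBase B) :
    M✶.IsBase Bᶜ := by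
  rw [Set.compl_eq_univ_sdiff, ← hA.ground_eq]
  exact hB.compl_isBase_dual

variable [Fintype E]

theorem Represents.isDependencySpace_rowSpace {A : Matrix ι E ℝ} {M : Matroid E}
    (hA : Represents A M) : IsDependencySpace M✶ (rowSpace A) := by
  rw [← perp_kernel]
  exact hA.isDependencySpace_kernel.dual

/-- A pair of points of `w + rowSpace A` and `ws + kernel A` with complementary zero sets
prescribed by `B`. -/
structure IsComplementaryPair (A : Matrix ι E ℝ) (w ws : E → ℝ) (B : Set E)
    (y ys : E → ℝ) : Prop where
  sub_mem_rowSpace : y - w ∈ rowSpace A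
  sub_mem_kernel : ys - ws ∈ kernel A
  eq_zero : ∀ e ∈ B, y e = 0
  eq_zero_of_notMem : ∀ e ∉ B, ys e = 0

variable {A : Matrix ι E ℝ} {M : Matroid E}

theorem Represents.exists_isComplementaryPair (hA : Represents A M) {B : Set E}
    (hB : M.IsBase B) (w ws : E → ℝ) : ∃ y ys, IsComplementaryPair A w ws B y ys := by
  obtain ⟨y, hy, hyB⟩ := hA.isDependencySpace_kernel.exists_sub_mem_perp_eq_zero hB.indep w
  obtain ⟨ys, hys, hysB⟩ := hA.isDependencySpace_rowSpace.exists_sub_mem_perp_eq_zero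
    (hA.isBase_compl hB).indep ws
  rw [perp_kernel] at hy
  rw [perp_rowSpace] at hys
  exact ⟨y, ys, hy, hys, hyB, hysB⟩

variable {σ : CircuitSignature M A} {σs : CocircuitSignature M A} {w ws : E → ℝ}

theorem IsComplementaryPair.basisOrientation_eq_of_notMem (hA : Represents A M)
    (hw : σ.IsInducedBy w) {B : {B : Set E // M.IsBase B}} {y ys : E → ℝ}
    (hp : IsComplementaryPair A w ws B.1 y ys) {e : E} (he : e ∉ B.1) :
    y e ≠ 0 ∧ basisOrientation hA σ σs B e = SignType.sign (y e) := by
  rw [basisOrientation, dif_neg he]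
  exact hw.apply_eq_sign (by rw [perp_kernel]; exact hp.sub_mem_rowSpace) hp.eq_zero _
    (M.fundCircuit_subset_insert e B.1)

theorem IsComplementaryPair.basisOrientation_eq_of_mem (hA : Represents A M)
    (hws : σs.IsInducedBy ws) {B : {B : Set E // M.IsBase B}} {y ys : E → ℝ}
    (hp : IsComplementaryPair A w ws B.1 y ys) {e : E} (he : e ∈ B.1) :
    ys e ≠ 0 ∧ basisOrientation hA σ σs B e = SignType.sign (ys e) := by
  rw [basisOrientation, dif_pos he]
  refine hws.apply_eq_sign (I := B.1ᶜ) (by rw [perp_rowSpace]; exact hp.sub_mem_kernel)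
    hp.eq_zero_of_notMem _ ((M✶.fundCircuit_subset_insert e (M✶.E \ B.1)).trans ?_)
  exact Set.insert_subset_insert fun x hx => hx.2

theorem basisOrientation_mem_compatibleOrientations (hA : Represents A M)
    (hw : σ.IsInducedBy w) (hws : σs.IsInducedBy ws) (B : {B : Set E // M.IsBase B}) :
    basisOrientation hA σ σs B ∈ compatibleOrientations σ σs := by
  obtain ⟨y, ys, hp⟩ := hA.exists_isComplementaryPair B.2 w ws
  have h1 : ∀ e ∉ B.1, _ := fun e he => hp.basisOrientation_eq_of_notMem (σs := σs) hA hw he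
  have h2 : ∀ e ∈ B.1, _ := fun e he => hp.basisOrientation_eq_of_mem (σ := σ) hA hws he
  refine ⟨fun e => ?_, ?_, ?_⟩
  · obtain ⟨x, hx0, hx⟩ : ∃ x : ℝ, x ≠ 0 ∧ basisOrientation hA σ σs B e = SignType.sign x := by
      by_cases he : e ∈ B.1
      exacts [⟨_, h2 e he⟩, ⟨_, h1 e he⟩]
    rw [hx]
    rcases hx0.lt_or_gt with hx0 | hx0
    · exact Or.inl (sign_neg hx0)
    · exact Or.inr (sign_pos hx0)
  · exact Signature.compatible_of_sign_eq hA.isDependencySpace_kernel hw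
      (by rw [perp_kernel]; exact hp.sub_mem_rowSpace) B.2.indep hp.eq_zero
      fun e he => (h1 e he).2
  · exact Signature.compatible_of_sign_eq hA.isDependencySpace_rowSpace hws
      (by rw [perp_rowSpace]; exact hp.sub_mem_kernel) (hA.isBase_compl B.2).indep
      hp.eq_zero_of_notMem fun e he => (h2 e (not_not.1 he)).2

theorem dotProduct_eq_zero_of_mem_rowSpace_of_mem_kernel {u v : E → ℝ} (hu : u ∈ rowSpace A)
    (hv : v ∈ kernel A) : u ⬝ᵥ v = 0 := by
  rw [← perp_kernel] at hu
  exact hu v hv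

theorem basisOrientation_injective (hA : Represents A M)
    (hw : σ.IsInducedBy w) (hws : σs.IsInducedBy ws) :
    Function.Injective (basisOrientation hA σ σs) := by
  intro B B' hBB'
  obtain ⟨y, ys, hp⟩ := hA.exists_isComplementaryPair B.2 w ws
  obtain ⟨y', ys', hp'⟩ := hA.exists_isComplementaryPair B'.2 w ws
  have hpos : ∀ e, e ∉ B.1 → e ∈ B'.1 → 0 < y e * ys' e := fun e he he' => by
    obtain ⟨-, h1⟩ := hp.basisOrientation_eq_of_notMem (σs := σs) hA hw he
    obtain ⟨h0, h2⟩ := hp'.basisOrientation_eq_of_mem (σ := σ) hA hws he'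
    exact mul_pos_of_sign_eq_sign (by rw [← h1, ← h2, hBB']) h0
  have hpos' : ∀ e, e ∈ B.1 → e ∉ B'.1 → 0 < y' e * ys e := fun e he he' => by
    obtain ⟨-, h1⟩ := hp'.basisOrientation_eq_of_notMem (σs := σs) hA hw he'
    obtain ⟨h0, h2⟩ := hp.basisOrientation_eq_of_mem (σ := σ) hA hws he
    exact mul_pos_of_sign_eq_sign (by rw [← h1, ← h2, hBB']) h0
  have hsum : ∑ e, (y e * ys' e + y' e * ys e) = 0 := by
    have h0 := dotProduct_eq_zero_of_mem_rowSpace_of_mem_kernel (u := y' - y) (v := ys - ys')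
      (by simpa using (rowSpace A).sub_mem hp'.sub_mem_rowSpace hp.sub_mem_rowSpace)
      (by simpa using (kernel A).sub_mem hp.sub_mem_kernel hp'.sub_mem_kernel)
    rw [← h0]
    refine Finset.sum_congr rfl fun e _ => ?_
    have h1 : y e * ys e = 0 := by
      by_cases he : e ∈ B.1
      · rw [hp.eq_zero e he, zero_mul]
      · rw [hp.eq_zero_of_notMem e he, mul_zero]
    have h2 : y' e * ys' e = 0 := by
      by_cases he : e ∈ B'.1
      · rw [hp'.eq_zero e he, zero_mul]
      · rw [hp'.eq_zero_of_notMem e he, mul_zero]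
    simp only [Pi.sub_apply]
    linear_combination h1 + h2
  have hnonneg : ∀ e ∈ Finset.univ, 0 ≤ y e * ys' e + y' e * ys e := fun e _ => by
    by_cases he : e ∈ B.1 <;> by_cases he' : e ∈ B'.1
    · simp [hp.eq_zero e he, hp'.eq_zero e he']
    · simpa [hp.eq_zero e he] using (hpos' e he he').le
    · simpa [hp'.eq_zero e he'] using (hpos e he he').le
    · simp [hp.eq_zero_of_notMem e he, hp'.eq_zero_of_notMem e he']
  rw [Finset.sum_eq_zero_iff_of_nonneg hnonneg] at hsum
  refine Subtype.ext (Set.ext fun e => ⟨fun he => ?_, fun he' => ?_⟩)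
  · by_contra he'
    have := hsum e (Finset.mem_univ e)
    rw [hp.eq_zero e he, zero_mul, zero_add] at this
    exact (hpos' e he he').ne' this
  · by_contra he
    have := hsum e (Finset.mem_univ e)
    rw [hp'.eq_zero e he', zero_mul, add_zero] at this
    exact (hpos e he he').ne' this

/-- A linear functional which is positive on the orthant of `O` attains its minimum over the
points of `w + U` in this orthant; at the minimum it is non-negative on the feasible
directions. -/
theorem exists_minimizer {U : Submodule ℝ (E → ℝ)} {O : E → SignType} (hO : IsOrientation O)
    {w y₀ z : E → ℝ} (hy₀ : y₀ - w ∈ U) (hy₀O : ∀ e, 0 ≤ (O e : ℝ) * y₀ e)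
    (hz : HasSigns z O) :
    ∃ y, y - w ∈ U ∧ (∀ e, 0 ≤ (O e : ℝ) * y e) ∧
      ∀ u ∈ U, (∀ e, y e = 0 → 0 ≤ (O e : ℝ) * u e) → 0 ≤ z ⬝ᵥ u := by
  set S : Set (E → ℝ) := {y | y - w ∈ U ∧ (∀ e, 0 ≤ (O e : ℝ) * y e) ∧ z ⬝ᵥ y ≤ z ⬝ᵥ y₀}
  have hzc : Continuous fun y : E → ℝ => z ⬝ᵥ y := by
    unfold dotProduct
    fun_prop
  have hSc : IsClosed S := by
    refine IsClosed.inter ?_ (IsClosed.inter ?_ (isClosed_le hzc continuous_const))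
    · exact (Submodule.closed_of_finiteDimensional U).preimage (continuous_id.sub continuous_const)
    · change IsClosed {y : E → ℝ | ∀ e, 0 ≤ (O e : ℝ) * y e}
      rw [Set.ofPred_forall]
      exact isClosed_iInter fun e =>
        isClosed_le continuous_const (continuous_const.mul (continuous_apply e))
  have hzO : ∀ e, 0 < (O e : ℝ) * z e := fun e => (hO.sign_eq_iff e _).1 (hz e)
  have hmul : ∀ (x : E → ℝ) e, z e * x e = ((O e : ℝ) * z e) * ((O e : ℝ) * x e) := fun x e => by
    linear_combination (- (z e * x e)) * hO.mul_self e
  have hbdd : S ⊆ Set.univ.pi fun e =>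
      Set.Icc (-(z ⬝ᵥ y₀ / ((O e : ℝ) * z e))) (z ⬝ᵥ y₀ / ((O e : ℝ) * z e)) := by
    rintro y ⟨-, hyO, hy⟩ e -
    have h1 : ((O e : ℝ) * z e) * ((O e : ℝ) * y e) ≤ z ⬝ᵥ y₀ := by
      rw [← hmul]
      refine le_trans ?_ hy
      refine Finset.single_le_sum (f := fun e => z e * y e) (fun x _ => ?_) (Finset.mem_univ e)
      rw [hmul]
      exact mul_nonneg (hzO x).le (hyO x)
    have h2 : (O e : ℝ) * y e ≤ z ⬝ᵥ y₀ / ((O e : ℝ) * z e) := by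
      rw [le_div_iff₀ (hzO e)]
      linarith
    have h3 := hyO e
    refine abs_le.1 ?_
    rcases hO e with h | h <;> simp only [h, SignType.coe_neg_one, SignType.coe_one] at h2 h3 ⊢
    · rw [abs_of_nonpos (by linarith)]
      linarith
    · rw [abs_of_nonneg (by linarith)]
      linarith
  obtain ⟨y, hyS, hmin⟩ := ((isCompact_univ_pi fun _ => isCompact_Icc).of_isClosed_subset hSc
    hbdd).exists_isMinOn ⟨y₀, hy₀, hy₀O, le_rfl⟩ hzc.continuousOn
  obtain ⟨hyw, hyO, hyy₀⟩ := hyS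
  refine ⟨y, hyw, hyO, fun u hu huO => ?_⟩
  by_contra! hneg
  have hev : ∀ᶠ ε : ℝ in nhdsWithin 0 (Set.Ioi 0), ∀ e, 0 ≤ (O e : ℝ) * (y e + ε * u e) := by
    refine Filter.eventually_all.2 fun e => ?_
    by_cases hye : y e = 0
    · filter_upwards [self_mem_nhdsWithin] with ε hε
      rw [hye, zero_add, mul_left_comm]
      exact mul_nonneg (le_of_lt hε) (huO e hye)
    · have hpos : 0 < (O e : ℝ) * (y e + 0 * u e) := by
        rw [zero_mul, add_zero]
        exact (hyO e).lt_of_ne' (mul_ne_zero (left_ne_zero_of_mul (hzO e).ne') hye)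
      have hc : Continuous fun ε : ℝ => (O e : ℝ) * (y e + ε * u e) := by fun_prop
      exact (((hc.tendsto 0).eventually_const_lt hpos).filter_mono nhdsWithin_le_nhds).mono
        fun ε hε => hε.le
  obtain ⟨ε, hε, hε0⟩ := (hev.and self_mem_nhdsWithin).exists
  have hlt : z ⬝ᵥ (y + ε • u) < z ⬝ᵥ y := by
    rw [dotProduct_add, dotProduct_smul, smul_eq_mul]
    have := mul_neg_of_pos_of_neg hε0 hneg
    linarith
  refine (hmin ⟨?_, fun e => ?_, hlt.le.trans hyy₀⟩).not_gt hlt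
  · rw [add_sub_right_comm]
    exact U.add_mem hyw (U.smul_mem ε hu)
  · exact hε e

theorem exists_basisOrientation_eq (hA : Represents A M)
    (hw : σ.IsInducedBy w) (hws : σs.IsInducedBy ws) {O : E → SignType}
    (hO : O ∈ compatibleOrientations σ σs) : ∃ B, basisOrientation hA σ σs B = O := by
  classical
  obtain ⟨hO, hσO, hσsO⟩ := hO
  obtain ⟨y₀, hy₀, hy₀O⟩ := hσO.exists_hasSigns hA.isDependencySpace_kernel hw hO
  obtain ⟨z, hz, hzO⟩ := hσsO.exists_hasSigns hA.isDependencySpace_rowSpace hws hO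
  rw [perp_rowSpace] at hz
  obtain ⟨y, hy, hyO, hmin⟩ := exists_minimizer hO hy₀
    (fun e => ((hO.sign_eq_iff e _).1 (hy₀O e)).le) hzO
  set Z : Set E := {e | y e = 0} with hZ
  have hZi : M.Indep Z := hw.indep_zeros hA.isDependencySpace_kernel hy
  choose b hb hbZ using fun e : E =>
    hA.isDependencySpace_kernel.exists_mem_perp_eqOn hZi (Pi.single e 1)
  rw [perp_kernel] at hy hmin hb
  have hzero : ∀ u ∈ rowSpace A, (∀ e ∈ Z, u e = 0) → z ⬝ᵥ u = 0 := by
    intro u hu huZ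
    refine le_antisymm ?_ (hmin u hu fun e he => by rw [huZ e he, mul_zero])
    have := hmin (-u) ((rowSpace A).neg_mem hu) fun e he => by
      rw [Pi.neg_apply, huZ e he, neg_zero, mul_zero]
    rw [dotProduct_neg] at this
    linarith
  set ys : E → ℝ := fun e => if e ∈ Z then z ⬝ᵥ b e else 0 with hys
  have hzys : z - ys ∈ kernel A := by
    rw [← perp_rowSpace]
    intro u hu
    have h0 := hzero (u - ∑ e, (if e ∈ Z then u e else 0) • b e)
      ((rowSpace A).sub_mem hu ((rowSpace A).sum_mem fun e _ => (rowSpace A).smul_mem _ (hb e)))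
      fun x hx => by
        rw [Pi.sub_apply, Finset.sum_apply, Finset.sum_eq_single x]
        · simp [hx, hbZ x x hx]
        · intro e _ he
          simp [hbZ e x hx, he.symm]
        · simp
    rw [dotProduct_sub, dotProduct_sum] at h0
    rw [sub_dotProduct, ← h0]
    congr 1
    refine Finset.sum_congr rfl fun e _ => ?_
    simp only [dotProduct_smul, smul_eq_mul, hys]
    split_ifs <;> ring
  have hysw : ys - ws ∈ kernel A := by
    simpa using (kernel A).sub_mem hz hzys
  have hysO : ∀ e ∈ Z, 0 ≤ (O e : ℝ) * ys e := by
    intro e he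
    have := hmin ((O e : ℝ) • b e) ((rowSpace A).smul_mem _ (hb e)) fun x hx => by
      rw [Pi.smul_apply, hbZ e x hx, smul_eq_mul]
      rcases eq_or_ne x e with rfl | hxe
      · rw [Pi.single_eq_same, mul_one, hO.mul_self]
        exact zero_le_one
      · simp [hxe]
    rw [dotProduct_smul, smul_eq_mul] at this
    simpa [hys, he] using this
  have hZs : M✶.Indep {e | ys e = 0} :=
    hws.indep_zeros hA.isDependencySpace_rowSpace (by rwa [perp_rowSpace])
  obtain ⟨B, hB, hZB⟩ := hZi.exists_isBase_superset
  have hsub : Zᶜ ⊆ {e | ys e = 0} := fun e he => if_neg he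
  have hBZ : B = Z := by
    refine subset_antisymm (Set.compl_subset_compl.1 ?_) hZB
    rw [(hA.isBase_compl hB).eq_of_subset_indep hZs ((Set.compl_subset_compl.2 hZB).trans hsub)]
    exact hsub
  rw [hBZ] at hB
  have hp : IsComplementaryPair A w ws Z y ys := ⟨hy, hysw, fun _ he => he, hsub⟩
  refine ⟨⟨Z, hB⟩, funext fun e => ?_⟩
  have hOe : (O e : ℝ) ≠ 0 := left_ne_zero_of_mul (by rw [hO.mul_self e]; exact one_ne_zero)
  by_cases he : e ∈ Z
  · obtain ⟨h0, h1⟩ := hp.basisOrientation_eq_of_mem (σ := σ) (B := ⟨Z, hB⟩) hA hws he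
    rw [h1, hO.sign_eq_iff]
    exact (hysO e he).lt_of_ne' (mul_ne_zero hOe h0)
  · obtain ⟨h0, h1⟩ := hp.basisOrientation_eq_of_notMem (σs := σs) (B := ⟨Z, hB⟩) hA hw he
    rw [h1, hO.sign_eq_iff]
    exact (hyO e).lt_of_ne' (mul_ne_zero hOe h0)

end BasisOrientations

end RealMatroid

theorem theorem1p9 {ι E : Type*} [Fintype ι] [Fintype E]
    (M : Matroid E) (A : Matrix ι E ℝ) (hA : RealMatroid.Represents A M)
    (σ : RealMatroid.CircuitSignature M A) (σs : RealMatroid.CocircuitSignature M A)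
    (hσ : σ.IsAcyclic) (hσs : σs.IsAcyclic) :
    Set.BijOn (RealMatroid.basisOrientation hA σ σs) Set.univ
      (RealMatroid.compatibleOrientations σ σs) := by
  obtain ⟨w, hw⟩ := hσ.exists_isInducedBy hA.isDependencySpace_kernel
  obtain ⟨ws, hws⟩ := hσs.exists_isInducedBy hA.isDependencySpace_rowSpace
  refine ⟨fun B _ => RealMatroid.basisOrientation_mem_compatibleOrientations hA hw hws B,
    (RealMatroid.basisOrientation_injective hA hw hws).injOn, fun O hO => ?_⟩
  obtain ⟨B, hB⟩ := RealMatroid.exists_basisOrientation_eq hA hw hws hO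
  exact ⟨B, trivial, hB⟩
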